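/- Let $(R,\mathfrak m,k)$ be a commutative Noetherian local ring of dimension $d$. For a finitely generated $R$-module $M$, let $\operatorname{depth} M$ be the supremum of the lengths of the $M$-regular sequences in $\mathfrak m$, and call $M$ Cohen--Macaulay (CM) if $M=0$ or $\operatorname{depth} M=\dim M$. Assume that $R$ is CM (as a module over itself) and has a canonical module $\omega$, i.e. a finitely generated CM $R$-module with $\dim\omega=d$, of finite injective dimension, and of type $1$, meaning $\dim_k\operatorname{Ext}_R^{d}(k,\omega)=1$. For a finitely generated CM $R$-module $M$ set $$M^{+}:=\operatorname{Ext}_R^{\,d-\dim M}(M,\omega)$$ (and $M^{+}:=0$ if $M=0$). Theorem. Let $M$ and $N$ be finitely generated CM $R$-modules. Then the following are equivalent: 1. $\operatorname{Ext}_R^i(M,N^{+})=0$ for all $i\gg0$; 2. $\operatorname{Ext}_R^i(N,M^{+})=0$ for all $i\gg0$; 3. $\operatorname{Tor}^R_i(M,N)=0$ for all $i\gg0$. -/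

import Mathlib

open CategoryTheory

universe u

noncomputable section

namespace CMVanishing

variable (R : Type u) [CommRing R]

/-- The Krull dimension of a module (the dimension of its support) as a natural number.
Over a Noetherian local ring the dimension of a nonzero module is a natural number, so nothing is
lost by this conversion. The zero module, whose dimension is `⊥`, is sent to `0`. -/
def dim (M : Type u) [AddCommGroup M] [Module R M] : ℕ :=
  ((Module.supportDim R M).unbotD 0).toNat

/-- The depth of a finitely generated module `M` over a local ring: the supremum of the lengths of
the `M`-regular sequences contained in the maximal ideal. If `M ≠ 0`, the condition
`M ≠ (x₁, …, xₙ) M` is automatic by Nakayama's lemma; dropping it only has the effect that the zero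
module has depth `⊤`, as is customary. -/
def depth [IsLocalRing R] (M : Type u) [AddCommGroup M] [Module R M] : ℕ∞ :=
  ⨆ (rs : List R) (_ : (∀ r ∈ rs, r ∈ IsLocalRing.maximalIdeal R) ∧
    RingTheory.Sequence.IsWeaklyRegular M rs), (rs.length : ℕ∞)

/-- A finitely generated module `M` over a Noetherian local ring is Cohen-Macaulay if `M = 0` or
`depth M = dim M`. -/
def IsCohenMacaulay [IsLocalRing R] (M : Type u) [AddCommGroup M] [Module R M] : Prop :=
  Subsingleton M ∨ (depth R M : WithBot ℕ∞) = Module.supportDim R M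

/-- The residue field `k` of `R`, as an `R`-module. -/
abbrev residueModule [IsLocalRing R] : ModuleCat.{u} R :=
  ModuleCat.of R (IsLocalRing.ResidueField R)

variable {R}

/-- `Ext^i(k, M)` is annihilated by the maximal ideal. -/
theorem isTorsionBySet_ext [IsLocalRing R] (M : ModuleCat.{u} R) (i : ℕ) :
    Module.IsTorsionBySet R (Abelian.Ext (residueModule R) M i)
      (IsLocalRing.maximalIdeal R : Set R) := by
  intro e r
  have hr : (r : R) ∈ Module.annihilator R (residueModule R) := by
    rw [Module.mem_annihilator]
    intro y
    change IsLocalRing.ResidueField R at y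
    change (r : R) • y = 0
    rw [Algebra.smul_def, IsLocalRing.ResidueField.algebraMap_eq,
      (IsLocalRing.residue_eq_zero_iff _).mpr r.2, zero_mul]
  have h := Abelian.Ext.postcomp_smul_id_eq_zero_of_mem_annihilator (M := M) hr i
  have h2 := ConcreteCategory.congr_hom h e
  rw [Abelian.Ext.smul_eq_comp_mk₀]
  exact h2

/-- The structure of a vector space over the residue field `k` on `Ext^i(k, M)`: the class of `r`
acts as `r`. -/
instance extResidueModule [IsLocalRing R] (M : ModuleCat.{u} R) (i : ℕ) :
    Module (IsLocalRing.ResidueField R) (Abelian.Ext (residueModule R) M i) :=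
  (isTorsionBySet_ext M i).module

/-- The type of `M`: the dimension over the residue field `k` of `Ext^t(k, M)`, where
`t = depth M`. -/
def cmType [IsLocalRing R] (M : ModuleCat.{u} R) : Cardinal.{u} :=
  Module.rank (IsLocalRing.ResidueField R)
    (Abelian.Ext (residueModule R) M (depth R M).toNat)

/-- A canonical module of a Cohen-Macaulay local ring: a finitely generated maximal Cohen-Macaulay
module of type `1` and of finite injective dimension. -/
structure IsCanonicalModule [IsLocalRing R] (ω : ModuleCat.{u} R) : Prop where
  finite : Module.Finite R ω
  isCohenMacaulay : IsCohenMacaulay R ω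
  supportDim_eq : Module.supportDim R ω = ringKrullDim R
  cmType_eq_one : cmType ω = 1
  injectiveDimension_ne_top : injectiveDimension ω ≠ ⊤

/-- The module `M⁺ = Ext^{dim R - dim M}(M, ω)`. The subtraction does not truncate, since
`dim M ≤ dim R`. For `M = 0` this is the zero module, whatever the degree is. -/
def plus (ω M : ModuleCat.{u} R) : ModuleCat.{u} R :=
  ModuleCat.of R (Abelian.Ext M ω (dim R R - dim R M))

/-- `Ext^i(M, N) = 0` for all `i ≫ 0`. -/
def ExtEventuallyZero (M N : ModuleCat.{u} R) : Prop :=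
  ∃ n : ℕ, ∀ i ≥ n, Subsingleton (Abelian.Ext M N i)

/-- `Tor_i(M, N) = 0` for all `i ≫ 0`. -/
def TorEventuallyZero (M N : ModuleCat.{u} R) : Prop :=
  ∃ n : ℕ, ∀ i ≥ n, Subsingleton (((Tor (ModuleCat.{u} R) i).obj M).obj N)

end CMVanishing

end

/-! Write `M^∨ = Hom_ℤ(M, ℚ/ℤ)` and `d = dim R`. In positive degrees `Ext^i(N, M^∨)` is the
character dual of `Tor_i(M, N)`, so condition 3 says that `Ext^i(N, M^∨) = 0` for large `i`, and
this is symmetric in `M` and `N`. The theorem thus reduces to one comparison,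
`extEventuallyZero_plus_iff`: for CM `M`, `Ext^i(N, M⁺)` vanishes for large `i` iff `Ext^i(N, M^∨)`
does.

The comparison is an induction along an `M`-regular sequence of length `dim M`. For its first
element `x`, the sequences `0 → M⁺ → M⁺ → (M/xM)⁺ → 0` and `0 → (M/xM)^∨ → M^∨ → M^∨ → 0`, with `x`
as the endomorphism, are exact. Nakayama, used directly on `Ext(N, M⁺)` and through duality on
`Tor(M, N)`, shows that each vanishing condition holds for `M` iff it holds for `M/xM`.

If `M ≠ 0` has finite length, then `M⁺ = Ext^d(M, ω)` is `Hom(M, J)`, where `J` is `ω` modulo an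
`ω`-regular sequence of length `d` in `Ann M`. On finitely generated modules killed by `Ann M`,
`Hom(-, J)` detects injectivity just as `ℚ/ℤ` does. Hence, for `0 → Z → L → N → 0` with `L` free,
`Ext^1(N, M⁺) = 0` and `Ext^1(N, M^∨) = 0` both say that `Z ⊗ M → L ⊗ M` is injective; dimension
shifting gives the higher degrees. What is used of `ω` is `ExtConcentrated`. -/

noncomputable section

namespace CMVanishing

open Abelian TensorProduct IsLocalRing

/-! ### Dimension shifting and `Ext¹` as an extension or lifting problem -/

section Ext

variable {R : Type u} [CommRing R]

/-- A finitely generated module is the cokernel of an injection of finitely generated modules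
whose target is free. -/
theorem exists_shortExact_free [IsNoetherianRing R] (X : ModuleCat.{u} R) [Module.Finite R X] :
    ∃ (Z L : ModuleCat.{u} R) (f : Z ⟶ L) (g : L ⟶ X) (w : f ≫ g = 0),
      (ShortComplex.mk f g w).ShortExact ∧ Module.Finite R Z ∧ Module.Finite R L ∧
        Module.Free R L := by
  obtain ⟨P, _, _, _, _, f, hf⟩ := Module.exists_finite_presentation R X
  exact ⟨_, _, _, _, _, LinearMap.shortExact_shortComplexKer hf,
    inferInstanceAs (Module.Finite R (LinearMap.ker f)), inferInstanceAs (Module.Finite R P),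
    inferInstanceAs (Module.Free R P)⟩

theorem projective_of_free (L : ModuleCat.{u} R) [Module.Free R L] : Projective L :=
  (IsProjective.iff_projective (R := R) L).mp (Module.Projective.of_free)

theorem subsingleton_ext_X₃_iff {S : ShortComplex (ModuleCat.{u} R)} (hS : S.ShortExact)
    (Y : ModuleCat.{u} R) {i j : ℕ} (hij : 1 + i = j) (hi : Subsingleton (Ext S.X₂ Y i))
    (hj : Subsingleton (Ext S.X₂ Y j)) :
    Subsingleton (Ext S.X₃ Y j) ↔ Subsingleton (Ext S.X₁ Y i) := by
  simp only [subsingleton_iff_forall_eq (0 : Ext _ _ _)]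
  constructor
  · intro h e
    obtain ⟨e', rfl⟩ := Ext.contravariant_sequence_exact₁ hS Y e hij (h _)
    rw [Subsingleton.elim e' 0, Ext.comp_zero]
  · intro h e
    obtain ⟨e', rfl⟩ := Ext.contravariant_sequence_exact₃ hS Y e (Subsingleton.elim _ _) hij
    rw [h e', Ext.comp_zero]

theorem subsingleton_ext_X₁_iff {S : ShortComplex (ModuleCat.{u} R)} (hS : S.ShortExact)
    (X : ModuleCat.{u} R) {i j : ℕ} (hij : i + 1 = j) (hi : Subsingleton (Ext X S.X₂ i))
    (hj : Subsingleton (Ext X S.X₂ j)) :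
    Subsingleton (Ext X S.X₁ j) ↔ Subsingleton (Ext X S.X₃ i) := by
  simp only [subsingleton_iff_forall_eq (0 : Ext _ _ _)]
  constructor
  · intro h e
    obtain ⟨e', rfl⟩ := Ext.covariant_sequence_exact₃ X hS e hij (h _)
    rw [Subsingleton.elim e' 0, Ext.zero_comp]
  · intro h e
    obtain ⟨e', rfl⟩ := Ext.covariant_sequence_exact₁ X hS e (Subsingleton.elim _ _) hij
    rw [h e', Ext.zero_comp]

theorem subsingleton_ext_of_projective (P Y : ModuleCat.{u} R) [Projective P] (i : ℕ) :
    Subsingleton (Ext P Y (i + 1)) :=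
  Ext.subsingleton_of_projective _ _ _

theorem subsingleton_ext_of_injective (X I : ModuleCat.{u} R) [Injective I] (i : ℕ) :
    Subsingleton (Ext X I (i + 1)) :=
  Ext.subsingleton_of_injective _ _ _

theorem subsingleton_ext_one_iff_of_projective {S : ShortComplex (ModuleCat.{u} R)}
    (hS : S.ShortExact) [Projective S.X₂] (Y : ModuleCat.{u} R) :
    Subsingleton (Ext S.X₃ Y 1) ↔ ∀ φ : S.X₁ ⟶ Y, ∃ ψ : S.X₂ ⟶ Y, S.f ≫ ψ = φ := by
  rw [subsingleton_iff_forall_eq (0 : Ext _ _ _)]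
  constructor
  · intro h φ
    obtain ⟨e, he⟩ := Ext.contravariant_sequence_exact₁ hS Y (Ext.mk₀ φ) (add_zero 1) (h _)
    obtain ⟨ψ, rfl⟩ := Ext.mk₀_bijective _ _ |>.2 e
    exact ⟨ψ, (Ext.mk₀_bijective _ _).1 (by simpa using he)⟩
  · intro h e
    obtain ⟨e', rfl⟩ := Ext.contravariant_sequence_exact₃ hS Y e
      ((subsingleton_ext_of_projective S.X₂ Y 0).elim _ _) (add_zero 1)
    obtain ⟨φ, rfl⟩ := Ext.mk₀_bijective _ _ |>.2 e'
    obtain ⟨ψ, rfl⟩ := h φ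
    rw [← Ext.mk₀_comp_mk₀, ShortComplex.ShortExact.extClass_comp_assoc]

theorem subsingleton_ext_one_iff_of_injective {S : ShortComplex (ModuleCat.{u} R)}
    (hS : S.ShortExact) [Injective S.X₂] (X : ModuleCat.{u} R) :
    Subsingleton (Ext X S.X₁ 1) ↔ ∀ φ : X ⟶ S.X₃, ∃ ψ : X ⟶ S.X₂, ψ ≫ S.g = φ := by
  rw [subsingleton_iff_forall_eq (0 : Ext _ _ _)]
  constructor
  · intro h φ
    obtain ⟨e, he⟩ := Ext.covariant_sequence_exact₃ X hS (Ext.mk₀ φ) (zero_add 1) (h _)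
    obtain ⟨ψ, rfl⟩ := Ext.mk₀_bijective _ _ |>.2 e
    exact ⟨ψ, (Ext.mk₀_bijective _ _).1 (by simpa using he)⟩
  · intro h e
    obtain ⟨e', rfl⟩ := Ext.covariant_sequence_exact₁ X hS e
      ((subsingleton_ext_of_injective X S.X₂ 0).elim _ _) (zero_add 1)
    obtain ⟨φ, rfl⟩ := Ext.mk₀_bijective _ _ |>.2 e'
    obtain ⟨ψ, rfl⟩ := h φ
    rw [← Ext.mk₀_comp_mk₀, Ext.comp_assoc_of_second_deg_zero,
      ShortComplex.ShortExact.comp_extClass, Ext.comp_zero]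

end Ext

/-! ### Character duals and their symmetry in Ext -/

section Character

variable {R : Type u} [CommRing R]

/-- The character module `Hom(M, ℚ/ℤ)`, as an object of the category of modules. -/
abbrev charDual (M : ModuleCat.{u} R) : ModuleCat.{u} R :=
  ModuleCat.of R (CharacterModule M)

/-- The dual of a linear map on character modules. -/
abbrev charDualMap {M N : ModuleCat.{u} R} (f : M ⟶ N) : charDual N ⟶ charDual M :=
  ModuleCat.ofHom (CharacterModule.dual f.hom)

theorem charDualMap_comp {M N P : ModuleCat.{u} R} (f : M ⟶ N) (g : N ⟶ P) :
    charDualMap g ≫ charDualMap f = charDualMap (f ≫ g) := rfl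

theorem charDualMap_zero {M N : ModuleCat.{u} R} : charDualMap (0 : M ⟶ N) = 0 := by
  ext c x
  exact map_zero c

/-- A character of `B` killing the image of `f` descends to `B / im f`, which embeds in `C` by
exactness; it extends to `C` because `ℚ/ℤ` is injective. -/
theorem exact_dual {A B C : Type*} [AddCommGroup A] [Module R A] [AddCommGroup B] [Module R B]
    [AddCommGroup C] [Module R C] {f : A →ₗ[R] B} {g : B →ₗ[R] C} (hfg : Function.Exact f g) :
    Function.Exact (CharacterModule.dual g) (CharacterModule.dual f) := by
  intro c
  constructor
  · intro hc
    obtain ⟨c', hc'⟩ := CharacterModule.dual_surjective_of_injective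
      (R := R) ((LinearMap.range f).liftQ g (LinearMap.range_le_ker_iff.mpr
        hfg.linearMap_comp_eq_zero))
      (by
        rw [← LinearMap.ker_eq_bot, Submodule.ker_liftQ_eq_bot']
        exact hfg.linearMap_ker_eq.symm)
      (QuotientAddGroup.lift _ c (by
        rintro _ ⟨a, rfl⟩
        exact DFunLike.congr_fun hc a))
    refine ⟨c', ?_⟩
    ext b
    exact DFunLike.congr_fun hc' (Submodule.Quotient.mk b)
  · rintro ⟨c, rfl⟩
    ext a
    change c (g (f a)) = 0
    rw [hfg.apply_apply_eq_zero, map_zero]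

/-- The dual of a short exact sequence. -/
abbrev charDualComplex (S : ShortComplex (ModuleCat.{u} R)) : ShortComplex (ModuleCat.{u} R) :=
  ShortComplex.mk (charDualMap S.g) (charDualMap S.f) (by
    rw [charDualMap_comp, S.zero, charDualMap_zero])

theorem shortExact_charDualComplex {S : ShortComplex (ModuleCat.{u} R)} (hS : S.ShortExact) :
    (charDualComplex S).ShortExact where
  exact := by
    rw [ShortComplex.ShortExact.moduleCat_exact_iff_function_exact]
    exact exact_dual ((ShortComplex.ShortExact.moduleCat_exact_iff_function_exact S).mp hS.exact)
  mono_f := (ModuleCat.mono_iff_injective _).mpr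
    (CharacterModule.dual_injective_of_surjective _ hS.moduleCat_surjective_g)
  epi_g := (ModuleCat.epi_iff_surjective _).mpr
    (CharacterModule.dual_surjective_of_injective _ hS.moduleCat_injective_f)

theorem injective_charDual (L : ModuleCat.{u} R) [Module.Flat R L] : Injective (charDual L) :=
  have := Module.Flat.iff_characterModule_injective (R := R) (M := L) |>.mp inferInstance
  Module.injective_object_of_injective_module R (CharacterModule L)

/-- A bilinear pairing `M × N → ℚ/ℤ`, seen from either side. -/
def charDualSwap {M N : ModuleCat.{u} R} (φ : M ⟶ charDual N) : N ⟶ charDual M :=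
  ModuleCat.ofHom
    { toFun := fun n => AddMonoidHom.mk' (fun m => (φ.hom m : CharacterModule N) n) (by
        intro a b
        rw [map_add]
        rfl)
      map_add' := by
        intro a b
        ext m
        exact map_add (φ.hom m : CharacterModule N) a b
      map_smul' := by
        intro r n
        ext m
        exact (DFunLike.congr_fun (φ.hom.map_smul r m) n).symm }

/-- Vanishing of the derived functors of the tensor product, expressed through character modules,
is symmetric. -/
theorem subsingleton_ext_charDual_comm [IsNoetherianRing R] (M N : ModuleCat.{u} R)
    [Module.Finite R N] (i : ℕ) :
    Subsingleton (Ext N (charDual M) (i + 1)) ↔ Subsingleton (Ext M (charDual N) (i + 1)) := by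
  induction i generalizing N with
  | zero =>
    obtain ⟨Z, L, f, g, w, hS, _, _, _⟩ := exists_shortExact_free N
    have := projective_of_free L
    have := injective_charDual L
    rw [zero_add, subsingleton_ext_one_iff_of_projective hS,
      subsingleton_ext_one_iff_of_injective (shortExact_charDualComplex hS)]
    -- Extending `Z → M^∨` to `L` and lifting `M → Z^∨` to `L^∨` are the same problem for pairings
    -- with `M`.
    constructor
    · intro h φ
      obtain ⟨ψ, hψ⟩ := h (charDualSwap φ)
      exact ⟨charDualSwap ψ, congrArg charDualSwap hψ⟩
    · intro h φ
      obtain ⟨ψ, hψ⟩ := h (charDualSwap φ)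
      exact ⟨charDualSwap ψ, congrArg charDualSwap hψ⟩
  | succ i ih =>
    obtain ⟨Z, L, f, g, w, hS, _, _, _⟩ := exists_shortExact_free N
    have := projective_of_free L
    have := injective_charDual L
    rw [subsingleton_ext_X₃_iff hS (charDual M) (add_comm 1 (i + 1))
      (subsingleton_ext_of_projective _ _ _) (subsingleton_ext_of_projective _ _ _),
      subsingleton_ext_X₁_iff (shortExact_charDualComplex hS) M rfl
        (subsingleton_ext_of_injective _ _ _) (subsingleton_ext_of_injective _ _ _)]
    exact ih Z

end Character

/-! ### Tor vanishing in terms of character duals -/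

section Character

variable {R : Type u} [CommRing R]

/-- Conversely, characters separate points: every character of `B / im f` kills the class of an
element of `ker g`. -/
theorem exact_dual_iff {A B C : Type*} [AddCommGroup A] [Module R A] [AddCommGroup B] [Module R B]
    [AddCommGroup C] [Module R C] {f : A →ₗ[R] B} {g : B →ₗ[R] C} (hfg : g ∘ₗ f = 0) :
    Function.Exact (CharacterModule.dual g) (CharacterModule.dual f) ↔ Function.Exact f g := by
  refine ⟨fun h => ?_, exact_dual⟩
  refine LinearMap.exact_of_comp_eq_zero_of_ker_le_range hfg fun b hb => ?_
  rw [← Submodule.Quotient.mk_eq_zero]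
  refine CharacterModule.eq_zero_of_character_apply fun c => ?_
  obtain ⟨c', hc'⟩ := (h (CharacterModule.dual (LinearMap.range f).mkQ c)).mp (by
    rw [← LinearMap.comp_apply, ← CharacterModule.dual_comp, LinearMap.range_mkQ_comp,
      CharacterModule.dual_zero, LinearMap.zero_apply])
  have := DFunLike.congr_fun hc' b
  rw [CharacterModule.dual_apply] at this
  refine this.symm.trans ?_
  change c' (g b) = 0
  rw [LinearMap.mem_ker.mp hb, map_zero]

/-- The homomorphism to a character module given by a character of a tensor product. -/
def charDualOfTensor {M P : ModuleCat.{u} R} (c : CharacterModule (M ⊗[R] P)) : P ⟶ charDual M :=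
  charDualSwap (ModuleCat.ofHom (CharacterModule.curry c))

theorem charDualOfTensor_bijective (M P : ModuleCat.{u} R) :
    Function.Bijective (charDualOfTensor (M := M) (P := P)) := by
  constructor
  · intro c c' h
    exact CharacterModule.homEquiv.symm.injective
      (congrArg (fun φ => (charDualSwap φ).hom) h)
  · intro φ
    refine ⟨CharacterModule.uncurry (charDualSwap φ).hom, ?_⟩
    have := CharacterModule.homEquiv.symm_apply_apply (charDualSwap φ).hom
    exact congrArg (fun t => charDualSwap (ModuleCat.ofHom t)) this

theorem comp_charDualOfTensor {M P Q : ModuleCat.{u} R} (f : P ⟶ Q)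
    (c : CharacterModule (M ⊗[R] Q)) :
    f ≫ charDualOfTensor c = charDualOfTensor (CharacterModule.dual (f.hom.lTensor M) c) := rfl

theorem charDualOfTensor_zero {M P : ModuleCat.{u} R} :
    charDualOfTensor (0 : CharacterModule (M ⊗[R] P)) = 0 := rfl

/-- By tensor-hom adjunction `Hom(P, M^∨)` is the dual of the complex `M ⊗ P`, and dualizing
preserves and reflects exactness. -/
theorem subsingleton_ext_charDual_iff_exact (M : ModuleCat.{u} R) {N : ModuleCat.{u} R}
    (P : ProjectiveResolution N) (n : ℕ) :
    Subsingleton (Ext N (charDual M) (n + 1)) ↔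
      Function.Exact ((P.complex.d (n + 2) (n + 1)).hom.lTensor M)
        ((P.complex.d (n + 1) n).hom.lTensor M) := by
  rw [← exact_dual_iff (by
    rw [← LinearMap.lTensor_comp, ← ModuleCat.hom_comp, P.complex.d_comp_d, ModuleCat.hom_zero,
      LinearMap.lTensor_zero]), subsingleton_iff_forall_eq (0 : Ext _ _ _)]
  have hzero : ∀ {P : ModuleCat.{u} R} (c : CharacterModule (M ⊗[R] P)),
      charDualOfTensor c = 0 ↔ c = 0 := fun c =>
    ⟨fun h => (charDualOfTensor_bijective M _).1 h, fun h => by rw [h, charDualOfTensor_zero]⟩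
  constructor
  · intro h c
    constructor
    · intro hc
      obtain ⟨ψ, hψ⟩ := (P.extMk_eq_zero_iff (charDualOfTensor c) (n + 2) rfl (by
        rw [comp_charDualOfTensor, hc, charDualOfTensor_zero]) n rfl).mp (h _)
      obtain ⟨c', rfl⟩ := (charDualOfTensor_bijective M _).2 ψ
      exact ⟨c', (charDualOfTensor_bijective M _).1 hψ⟩
    · rintro ⟨c, rfl⟩
      rw [← hzero, ← comp_charDualOfTensor, ← comp_charDualOfTensor, P.complex.d_comp_d_assoc,
        Limits.zero_comp]
  · intro h e
    obtain ⟨φ, hφ, rfl⟩ := P.extMk_surjective e (n + 2) rfl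
    obtain ⟨c, rfl⟩ := (charDualOfTensor_bijective M _).2 φ
    rw [P.extMk_eq_zero_iff _ _ _ _ n rfl]
    rw [comp_charDualOfTensor, hzero] at hφ
    obtain ⟨c', hc'⟩ := (h c).mp hφ
    exact ⟨charDualOfTensor c', congrArg charDualOfTensor hc'⟩

theorem subsingleton_tor_iff (M N : ModuleCat.{u} R) (n : ℕ) :
    Subsingleton (((Tor (ModuleCat.{u} R) (n + 1)).obj M).obj N) ↔
      Subsingleton (Ext N (charDual M) (n + 1)) := by
  let P := projectiveResolution N
  rw [subsingleton_ext_charDual_iff_exact M P n, ← ModuleCat.isZero_iff_subsingleton, Tor_obj,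
    (P.isoLeftDerivedObj ((MonoidalCategory.tensoringLeft (ModuleCat.{u} R)).obj M)
      (n + 1)).isZero_iff]
  refine (HomologicalComplex.exactAt_iff_isZero_homology _ _).symm.trans ?_
  rw [HomologicalComplex.exactAt_iff' _ (n + 2) (n + 1) n (by simp) (by simp),
    ShortComplex.ShortExact.moduleCat_exact_iff_function_exact]
  rfl

end Character

/-! ### Nakayama and reduction modulo a regular element -/

section Nakayama

variable {R : Type u} [CommRing R]

theorem isSMulRegular_ext {A Y : ModuleCat.{u} R} (N : ModuleCat.{u} R) {x : R} {f : A ⟶ Y}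
    {w : f ≫ (x • 𝟙 Y) = 0} (hS : (ShortComplex.mk f (x • 𝟙 Y) w).ShortExact) {i : ℕ}
    (h : Subsingleton (Ext N A i)) : IsSMulRegular (Ext N Y i) x := by
  rw [isSMulRegular_iff_right_eq_zero_of_smul]
  intro e he
  obtain ⟨e', rfl⟩ := Ext.covariant_sequence_exact₂ N hS e (by
    rw [Ext.mk₀_smul, Ext.comp_smul, Ext.comp_mk₀_id, he])
  rw [h.elim e' 0, Ext.zero_comp]

variable [IsLocalRing R]

theorem subsingleton_of_surjective_lsmul {K : Type*} [AddCommGroup K] [Module R K]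
    [Module.Finite R K] {x : R} (hx : x ∈ IsLocalRing.maximalIdeal R)
    (h : Function.Surjective fun k : K => x • k) : Subsingleton K := by
  rw [← Submodule.subsingleton_iff R, ← subsingleton_iff_bot_eq_top, eq_comm]
  refine Submodule.eq_bot_of_le_smul_of_le_jacobson_bot (IsLocalRing.maximalIdeal R) ⊤
    Module.Finite.fg_top (fun k _ => ?_) (IsLocalRing.maximalIdeal_le_jacobson _)
  obtain ⟨k, rfl⟩ := h k
  exact Submodule.smul_mem_smul hx trivial

variable [IsNoetherianRing R]

/-- The cokernel of the dual of `T` is `(ker T)^∨`. The hypothesis makes `x` injective there, hence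
surjective on the finitely generated module `ker T`, which is then zero. -/
theorem injective_of_smul_mem_range_dual {A B : Type*} [AddCommGroup A] [Module R A]
    [AddCommGroup B] [Module R B] [Module.Finite R A] {T : A →ₗ[R] B} {x : R}
    (hx : x ∈ IsLocalRing.maximalIdeal R)
    (h : ∀ c : CharacterModule A, x • c ∈ LinearMap.range (CharacterModule.dual T) →
      c ∈ LinearMap.range (CharacterModule.dual T)) : Function.Injective T := by
  have hex := exact_dual (LinearMap.exact_subtype_ker_map T)
  rw [← LinearMap.ker_eq_bot, ← Submodule.subsingleton_iff_eq_bot]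
  refine subsingleton_of_surjective_lsmul hx (CharacterModule.surjective_of_dual_injective
    (LinearMap.lsmul R (LinearMap.ker T) x) ?_)
  rw [← LinearMap.ker_eq_bot, LinearMap.ker_eq_bot']
  intro c hc
  obtain ⟨c, rfl⟩ := CharacterModule.dual_surjective_of_injective _
    (LinearMap.ker T).injective_subtype c
  refine (hex c).mpr (h c ((hex (x • c)).mp ?_))
  rw [map_smul]
  exact hc

/-- Nakayama's lemma for the character duals of the modules `Tor(M, N)`. -/
theorem subsingleton_ext_charDual_of_isSMulRegular (M N : ModuleCat.{u} R) [Module.Finite R M]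
    [Module.Finite R N] {x : R} (hx : x ∈ IsLocalRing.maximalIdeal R) (i : ℕ)
    (h : IsSMulRegular (Ext N (charDual M) (i + 1)) x) :
    Subsingleton (Ext N (charDual M) (i + 1)) := by
  induction i generalizing N with
  | zero =>
    obtain ⟨Z, L, f, g, w, hS, _, _, _⟩ := exists_shortExact_free N
    have := projective_of_free L
    -- The kernel of this map is `Tor_1(M, N)`, whose dual is `Ext^1(N, M^∨)`.
    have hinj : Function.Injective (f.hom.lTensor M) := by
      refine injective_of_smul_mem_range_dual hx fun c ⟨c', hc'⟩ => ?_
      have he : hS.extClass.comp (Ext.mk₀ (charDualOfTensor c)) (add_zero 1) = 0 := by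
        refine h (?_ : x • _ = x • _)
        have hxc : x • charDualOfTensor c = f ≫ charDualOfTensor c' := by
          rw [comp_charDualOfTensor, hc']
          rfl
        rw [smul_zero, ← Ext.comp_smul, ← Ext.mk₀_smul, hxc, ← Ext.mk₀_comp_mk₀]
        exact hS.extClass_comp_assoc _
      obtain ⟨e, he'⟩ := Ext.contravariant_sequence_exact₁ hS _ _ _ he
      obtain ⟨ψ, rfl⟩ := Ext.mk₀_bijective _ _ |>.2 e
      obtain ⟨b, rfl⟩ := (charDualOfTensor_bijective M _).2 ψ
      have hb : f ≫ charDualOfTensor b = charDualOfTensor c := by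
        refine (Ext.mk₀_bijective _ _).1 ?_
        rw [← Ext.mk₀_comp_mk₀]
        exact he'
      rw [comp_charDualOfTensor] at hb
      exact ⟨b, (charDualOfTensor_bijective M _).1 hb⟩
    rw [zero_add, subsingleton_ext_one_iff_of_projective hS]
    intro φ
    obtain ⟨c, rfl⟩ := (charDualOfTensor_bijective M _).2 φ
    obtain ⟨b, rfl⟩ := CharacterModule.dual_surjective_of_injective (f.hom.lTensor M)
      hinj c
    exact ⟨charDualOfTensor b, rfl⟩
  | succ i ih =>
    obtain ⟨Z, L, f, g, w, hS, _, _, _⟩ := exists_shortExact_free N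
    have := projective_of_free L
    rw [subsingleton_ext_X₃_iff hS (charDual M) (add_comm 1 (i + 1))
      (subsingleton_ext_of_projective _ _ _) (subsingleton_ext_of_projective _ _ _)]
    -- Regularity passes to `Z` because the connecting map `Ext^{i+1}(Z, -) → Ext^{i+2}(N, -)` is
    -- injective, `L` being projective.
    refine ih Z ?_
    rw [isSMulRegular_iff_right_eq_zero_of_smul]
    intro e he
    have : hS.extClass.comp e (add_comm 1 (i + 1)) = 0 := by
      refine h (?_ : x • _ = x • _)
      rw [smul_zero, ← Ext.comp_smul, he, Ext.comp_zero]
    obtain ⟨e', rfl⟩ := Ext.contravariant_sequence_exact₁ hS _ _ _ this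
    rw [(subsingleton_ext_of_projective L _ _).elim e' 0, Ext.comp_zero]

theorem extEventuallyZero_charDual_quotSMulTop_iff (M N : ModuleCat.{u} R) [Module.Finite R M]
    [Module.Finite R N] {x : R} (hx : x ∈ IsLocalRing.maximalIdeal R) (hM : IsSMulRegular M x) :
    ExtEventuallyZero N (charDual (ModuleCat.of R (QuotSMulTop x M))) ↔
      ExtEventuallyZero N (charDual M) := by
  have hS := shortExact_charDualComplex hM.smulShortComplex_shortExact
  constructor
  · rintro ⟨n, hn⟩
    refine ⟨n + 1, fun i hi => ?_⟩
    obtain ⟨i, rfl⟩ := Nat.exists_eq_succ_of_ne_zero (show i ≠ 0 by omega)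
    refine subsingleton_ext_charDual_of_isSMulRegular M N hx i ?_
    exact isSMulRegular_ext N (f := (charDualComplex (M.smulShortComplex x)).f)
      (w := (charDualComplex (M.smulShortComplex x)).zero) hS (hn (i + 1) (by omega))
  · rintro ⟨n, hn⟩
    refine ⟨n + 1, fun i hi => ?_⟩
    obtain ⟨i, rfl⟩ := Nat.exists_eq_succ_of_ne_zero (show i ≠ 0 by omega)
    exact (subsingleton_ext_X₁_iff hS N rfl (hn i (by omega)) (hn (i + 1) (by omega))).mpr
      (hn i (by omega))

theorem extEventuallyZero_X₃_iff {Y Q : ModuleCat.{u} R} (N : ModuleCat.{u} R) [Module.Finite R Y]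
    [Module.Finite R N] {x : R} (hx : x ∈ IsLocalRing.maximalIdeal R) {g : Y ⟶ Q}
    {w : (x • 𝟙 Y) ≫ g = 0} (hS : (ShortComplex.mk (x • 𝟙 Y) g w).ShortExact) :
    ExtEventuallyZero N Q ↔ ExtEventuallyZero N Y := by
  constructor
  · rintro ⟨n, hn⟩
    refine ⟨n, fun i hi => ?_⟩
    refine subsingleton_of_surjective_lsmul hx fun e => ?_
    obtain ⟨e', rfl⟩ := Ext.covariant_sequence_exact₂ N hS e ((hn i hi).elim _ _)
    exact ⟨e', by simp [Ext.mk₀_smul, Ext.comp_smul]⟩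
  · rintro ⟨n, hn⟩
    exact ⟨n, fun i hi => (subsingleton_ext_X₁_iff hS N rfl (hn i hi) (hn (i + 1) (by omega))).mp
      (hn (i + 1) (by omega))⟩

end Nakayama

/-! ### Dévissage for modules supported at the closed point -/

section FiniteLength

variable {R : Type u} [CommRing R]

theorem subsingleton_ext_congr {X X' Y Y' : ModuleCat.{u} R} (e : X ≅ X') (e' : Y ≅ Y') (i : ℕ) :
    Subsingleton (Ext X Y i) ↔ Subsingleton (Ext X' Y' i) := by
  have key : ∀ {X X' Y Y' : ModuleCat.{u} R} (_ : X ≅ X') (_ : Y ≅ Y'),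
      Subsingleton (Ext X Y i) → Subsingleton (Ext X' Y' i) := fun e e' h =>
    Function.Injective.subsingleton
      (f := fun t => (Ext.mk₀ e.hom).comp (t.comp (Ext.mk₀ e'.inv) (add_zero i)) (zero_add i))
      (Function.LeftInverse.injective
        (g := fun t => (Ext.mk₀ e.inv).comp (t.comp (Ext.mk₀ e'.hom) (add_zero i)) (zero_add i))
        (fun t => by simp [Ext.comp_assoc_of_third_deg_zero, Ext.comp_assoc_of_second_deg_zero]))
  exact ⟨key e e', key e.symm e'.symm⟩

/-- A monomorphism, completed to a short exact sequence. -/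
theorem shortExact_cokernel {A B : ModuleCat.{u} R} {f : A ⟶ B} (hf : Function.Injective f.hom) :
    (ShortComplex.mk f (ModuleCat.ofHom (LinearMap.range f.hom).mkQ) (by
      ext a
      exact (Submodule.Quotient.mk_eq_zero _).mpr ⟨a, rfl⟩)).ShortExact where
  exact := by
    rw [ShortComplex.ShortExact.moduleCat_exact_iff_function_exact]
    exact LinearMap.exact_map_mkQ_range f.hom
  mono_f := (ModuleCat.mono_iff_injective _).mpr hf
  epi_g := (ModuleCat.epi_iff_surjective _).mpr (Submodule.mkQ_surjective _)

variable [IsLocalRing R]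

/-- The support of `H` contains no prime ideal other than the maximal one. -/
def SupportedAtClosedPoint (H : Type u) [AddCommGroup H] [Module R H] : Prop :=
  Module.support R H ⊆ PrimeSpectrum.zeroLocus (maximalIdeal R)

theorem SupportedAtClosedPoint.eq_maximalIdeal {H : Type u} [AddCommGroup H] [Module R H]
    (hH : SupportedAtClosedPoint (R := R) H) {p : PrimeSpectrum R} {f : R ⧸ p.asIdeal →ₗ[R] H}
    (hf : Function.Injective f) : p.asIdeal = maximalIdeal R := by
  have hp : p ∈ Module.support R (R ⧸ p.asIdeal) := by
    rw [Module.support_eq_zeroLocus, Ideal.annihilator_quotient, PrimeSpectrum.mem_zeroLocus]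
  exact le_antisymm (le_maximalIdeal p.2.ne_top)
    (hH (Module.support_subset_of_injective f hf hp))

variable [IsNoetherianRing R]

theorem exists_injective_residueModule (H : ModuleCat.{u} R) [Nontrivial H]
    (hH : SupportedAtClosedPoint (R := R) H) :
    ∃ f : residueModule R ⟶ H, Function.Injective f.hom := by
  obtain ⟨p, hp⟩ := associatedPrimes.nonempty R H
  obtain ⟨hp, f, hf⟩ := (isAssociatedPrime_iff_exists_injective_linearMap _ _).mp hp
  obtain rfl : p = maximalIdeal R := hH.eq_maximalIdeal (p := ⟨p, hp⟩) hf
  exact ⟨ModuleCat.ofHom (X := ResidueField R) f, hf⟩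

/-- In a prime filtration of `H` every factor `R/p` is supported at the closed point, so it is `k`;
vanishing passes through extensions. -/
theorem SupportedAtClosedPoint.subsingleton_ext (Y : ModuleCat.{u} R) {i : ℕ}
    (h : Subsingleton (Ext (residueModule R) Y i)) (H : ModuleCat.{u} R) [Module.Finite R H]
    (hH : SupportedAtClosedPoint (R := R) H) : Subsingleton (Ext H Y i) := by
  refine IsNoetherianRing.induction_on_isQuotientEquivQuotientPrime R (M := H) inferInstance
    (motive := fun N _ _ _ => SupportedAtClosedPoint (R := R) N →
      Subsingleton (Ext (ModuleCat.of R N) Y i)) ?_ ?_ ?_ hH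
  · intro N _ _ _ _ _
    have : Projective (ModuleCat.of R N) :=
      (ModuleCat.isZero_of_subsingleton (ModuleCat.of R N)).projective
    cases i with
    | zero =>
      have : Subsingleton (ModuleCat.of R N ⟶ Y) :=
        ⟨fun f g => (ModuleCat.isZero_of_subsingleton (ModuleCat.of R N)).eq_of_src f g⟩
      exact Ext.homEquiv₀.subsingleton
    | succ i => exact subsingleton_ext_of_projective _ _ _
  · intro N _ _ _ p e hN
    have hp : p.asIdeal = maximalIdeal R := hN.eq_maximalIdeal e.symm.injective
    have e' : N ≃ₗ[R] R ⧸ maximalIdeal R := e.trans (Submodule.quotEquivOfEq _ _ hp)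
    exact (subsingleton_ext_congr (X' := residueModule R) e'.toModuleIso (Iso.refl Y) i).mpr h
  · intro A _ _ _ B _ _ _ C _ _ _ f g hf hg hfg hA hC hB
    have hS : (ShortComplex.mk (ModuleCat.ofHom f) (ModuleCat.ofHom g) (by
        ext a
        exact hfg.apply_apply_eq_zero a)).ShortExact :=
      { exact := (ShortComplex.ShortExact.moduleCat_exact_iff_function_exact _).mpr hfg
        mono_f := (ModuleCat.mono_iff_injective _).mpr hf
        epi_g := (ModuleCat.epi_iff_surjective _).mpr hg }
    have hA' := hA ((Module.support_subset_of_injective f hf).trans hB)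
    have hC' := hC ((Module.support_subset_of_surjective g hg).trans hB)
    refine subsingleton_of_forall_eq 0 fun e => ?_
    obtain ⟨e', rfl⟩ := Ext.contravariant_sequence_exact₂ hS Y e (hA'.elim _ _)
    rw [hC'.elim e' 0, Ext.comp_zero]

end FiniteLength

/-! ### Representing Ext by Hom modulo a regular sequence -/

section Representing

variable {R : Type u} [CommRing R]

/-- Since `a` kills `H`, it acts as zero on `Ext(H, Y)`, so the connecting map is onto; its kernel
comes from `Ext^n(H, Y) = 0`. -/
theorem extClass_comp_bijective {Y Q : ModuleCat.{u} R} {a : R} {g : Y ⟶ Q}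
    {w : (a • 𝟙 Y) ≫ g = 0} (hS : (ShortComplex.mk (a • 𝟙 Y) g w).ShortExact) (H : ModuleCat.{u} R)
    (ha : a ∈ Module.annihilator R H) {n : ℕ} (h : Subsingleton (Ext H Y n)) :
    Function.Bijective fun e : Ext H Q n => e.comp hS.extClass (rfl : n + 1 = n + 1) := by
  constructor
  · refine (injective_iff_map_eq_zero (hS.extClass.postcomp H rfl)).mpr fun e he => ?_
    obtain ⟨e', rfl⟩ := Ext.covariant_sequence_exact₃ H hS e rfl he
    rw [h.elim e' 0, Ext.zero_comp]
  · intro e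
    refine Ext.covariant_sequence_exact₁ H hS e ?_ rfl
    have hzero : a • 𝟙 H = 0 := by
      ext x
      exact Module.mem_annihilator.mp ha x
    calc
      e.comp (Ext.mk₀ (a • 𝟙 Y)) (add_zero (n + 1))
        = (Ext.mk₀ (a • 𝟙 H)).comp e (zero_add (n + 1)) := by
          simp only [Ext.mk₀_smul, Ext.comp_smul, Ext.smul_comp, Ext.comp_mk₀_id, Ext.mk₀_id_comp]
      _ = 0 := by rw [hzero, Ext.mk₀_zero, Ext.zero_comp]

/-- The short exact sequence `0 → Y → Y → Y/aY → 0` given by a regular element `a`. -/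
theorem exists_shortExact_quotSMulTop {Y : ModuleCat.{u} R} {a : R} (ha : IsSMulRegular Y a) :
    ∃ (g : Y ⟶ ModuleCat.of R (QuotSMulTop a Y)) (w : (a • 𝟙 Y) ≫ g = 0),
      (ShortComplex.mk (a • 𝟙 Y) g w).ShortExact :=
  ⟨_, _, ha.smulShortComplex_shortExact⟩

/-- If `rs` is a regular sequence in `I`, then `Ext^{|rs|}(-, ω)` is representable on
finitely generated modules annihilated by `I`. -/
theorem exists_ext_comp_bijective [IsNoetherianRing R] {I : Ideal R}
    (ω : ModuleCat.{u} R) [Module.Finite R ω] (rs : List R) (hrs : ∀ r ∈ rs, r ∈ I)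
    (hI : I ≤ Ideal.jacobson ⊥) (h : RingTheory.Sequence.IsRegular ω rs) :
    ∃ (J : ModuleCat.{u} R) (δ : Ext J ω rs.length), ∀ (H : ModuleCat.{u} R) [Module.Finite R H],
      I ≤ Module.annihilator R H →
        Function.Bijective fun φ : H ⟶ J => (Ext.mk₀ φ).comp δ (zero_add _) := by
  induction rs generalizing ω with
  | nil =>
    refine ⟨ω, Ext.mk₀ (𝟙 ω), fun H _ _ => ?_⟩
    simpa using Ext.mk₀_bijective H ω
  | cons a rs ih =>
    have hω := h
    rw [RingTheory.Sequence.isRegular_cons_iff] at h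
    obtain ⟨J, δ, hJ⟩ := ih (ModuleCat.of R (QuotSMulTop a ω))
      (fun r hr => hrs r (List.mem_cons_of_mem a hr)) h.2
    obtain ⟨g, w, hS⟩ := exists_shortExact_quotSMulTop h.1
    refine ⟨J, δ.comp hS.extClass rfl, fun H _ hH => ?_⟩
    have hcomp : (fun φ : H ⟶ J => (Ext.mk₀ φ).comp (δ.comp hS.extClass rfl)
        (zero_add (rs.length + 1))) = (fun e : Ext H (ModuleCat.of R (QuotSMulTop a ω)) rs.length =>
          e.comp hS.extClass rfl) ∘ fun φ : H ⟶ J => (Ext.mk₀ φ).comp δ (zero_add _) := by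
      funext φ
      exact (Ext.comp_assoc _ _ _ _ _ (by omega)).symm
    have : Nontrivial ω := hω.nontrivial
    have hlt : I • (⊤ : Submodule R ω) < ⊤ :=
      lt_top_iff_ne_top.mpr (Ne.symm (Submodule.top_ne_ideal_smul_of_le_jacobson_annihilator
        (hI.trans (Ideal.jacobson_mono bot_le))))
    rw [hcomp]
    refine Function.Bijective.comp (extClass_comp_bijective hS H
      (hH (hrs a List.mem_cons_self)) ?_) (hJ H hH)
    -- The full sequence has one more element than `rs`, so `Ext^{|rs|}(H, ω)` is still in the
    -- vanishing range.
    exact ModuleCat.subsingleton_ext_of_exists_isRegular I H (by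
      rw [Module.support_eq_zeroLocus]
      exact PrimeSpectrum.zeroLocus_anti_mono hH) ω hlt (a :: rs) hrs hω rs.length (by simp)

end Representing

/-! ### Duality into a module with concentrated Ext -/

section Concentrated

variable {R : Type u} [CommRing R]

theorem annihilator_le_annihilator_tensor (Z M : Type u) [AddCommGroup Z] [Module R Z]
    [AddCommGroup M] [Module R M] :
    Module.annihilator R M ≤ Module.annihilator R (Z ⊗[R] M) := by
  intro r hr
  rw [Module.mem_annihilator] at hr ⊢
  intro t
  induction t with
  | zero => exact smul_zero r
  | tmul z m => rw [← TensorProduct.tmul_smul, hr m, TensorProduct.tmul_zero]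
  | add a b ha hb => rw [smul_add, ha, hb, add_zero]

theorem exists_shortExact_ext {M Q : ModuleCat.{u} R} {x : R} {g : M ⟶ Q} {w : (x • 𝟙 M) ≫ g = 0}
    (hS : (ShortComplex.mk (x • 𝟙 M) g w).ShortExact) (ω : ModuleCat.{u} R) {c : ℕ}
    (hQ : Subsingleton (Ext Q ω c)) (hM : Subsingleton (Ext M ω (c + 1))) :
    ∃ (g' : ModuleCat.of R (Ext M ω c) ⟶ ModuleCat.of R (Ext Q ω (c + 1)))
      (w' : (x • 𝟙 (ModuleCat.of R (Ext M ω c))) ≫ g' = 0),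
      (ShortComplex.mk (x • 𝟙 (ModuleCat.of R (Ext M ω c))) g' w').ShortExact := by
  have hsmul : ∀ e : Ext M ω c, (Ext.mk₀ (x • 𝟙 M)).comp e (zero_add c) = x • e := fun e => by
    simp [Ext.mk₀_smul]
  have hex : Function.Exact (fun e : Ext M ω c => x • e)
      (hS.extClass.precompOfLinear R ω (add_comm 1 c)) := by
    intro e
    constructor
    · intro he
      obtain ⟨e', rfl⟩ := Ext.contravariant_sequence_exact₁ hS ω e (add_comm 1 c) he
      exact ⟨e', (hsmul e').symm⟩
    · rintro ⟨e, rfl⟩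
      dsimp only
      rw [← hsmul]
      exact hS.extClass_comp_assoc e (h := add_comm 1 c)
  refine ⟨ModuleCat.ofHom (X := Ext M ω c) (hS.extClass.precompOfLinear R ω (add_comm 1 c)),
    ?_, { exact := ?_, mono_f := ?_, epi_g := ?_ }⟩
  · ext e
    exact hex.apply_apply_eq_zero e
  · exact (ShortComplex.ShortExact.moduleCat_exact_iff_function_exact _).mpr hex
  · refine (ModuleCat.mono_iff_injective _).mpr ?_
    refine (injective_iff_map_eq_zero (x • 𝟙 (ModuleCat.of R (Ext M ω c))).hom).mpr fun e he => ?_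
    change Ext M ω c at e
    obtain ⟨e', rfl⟩ := Ext.contravariant_sequence_exact₂ hS ω e ((hsmul e).trans he)
    rw [hQ.elim e' 0, Ext.comp_zero]
  · refine (ModuleCat.epi_iff_surjective _).mpr fun e => ?_
    change Ext Q ω (c + 1) at e
    exact Ext.contravariant_sequence_exact₃ hS ω e (hM.elim _ _) (add_comm 1 c)

variable [IsLocalRing R]

/-- `ω` is a finitely generated module such that `Ext^i(k, ω)` is nonzero exactly for `i = d`. -/
structure ExtConcentrated (ω : ModuleCat.{u} R) (d : ℕ) : Prop where
  finite : Module.Finite R ω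
  subsingleton_ext : ∀ i, i ≠ d → Subsingleton (Ext (residueModule R) ω i)
  nontrivial_ext : Nontrivial (Ext (residueModule R) ω d)

namespace ExtConcentrated

variable {ω : ModuleCat.{u} R} {d : ℕ}

theorem nontrivial (hω : ExtConcentrated ω d) : Nontrivial ω := by
  by_contra h
  rw [not_nontrivial_iff_subsingleton] at h
  have := hω.nontrivial_ext
  obtain ⟨e, he⟩ := exists_ne (0 : Ext (residueModule R) ω d)
  apply he
  rw [← e.comp_mk₀_id, (Limits.IsZero.iff_id_eq_zero ω).mp (ModuleCat.isZero_of_subsingleton ω),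
    Ext.mk₀_zero, Ext.comp_zero]

variable [IsNoetherianRing R]

theorem subsingleton_ext_of_supported (hω : ExtConcentrated ω d) (H : ModuleCat.{u} R)
    [Module.Finite R H] (hH : SupportedAtClosedPoint (R := R) H) {i : ℕ} (hi : i ≠ d) :
    Subsingleton (Ext H ω i) :=
  SupportedAtClosedPoint.subsingleton_ext ω (hω.subsingleton_ext i hi) H hH

/-- The obstruction lies in `Ext^{d+1}(B/A, ω)`, which vanishes by dévissage. -/
theorem exists_comp_eq (hω : ExtConcentrated ω d) {A B : ModuleCat.{u} R} [Module.Finite R B]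
    (hB : SupportedAtClosedPoint (R := R) B) {f : A ⟶ B} (hf : Function.Injective f.hom)
    (e : Ext A ω d) : ∃ e' : Ext B ω d, (Ext.mk₀ f).comp e' (zero_add d) = e := by
  refine Ext.contravariant_sequence_exact₁ (shortExact_cokernel hf) ω e (add_comm 1 d) ?_
  have : SupportedAtClosedPoint (R := R) (B ⧸ LinearMap.range f.hom) :=
    (Module.support_subset_of_surjective _ (Submodule.mkQ_surjective _)).trans hB
  exact (hω.subsingleton_ext_of_supported (ModuleCat.of R (B ⧸ LinearMap.range f.hom)) this
    (Nat.succ_ne_self d)).elim _ _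

theorem nontrivial_ext_of_supported (hω : ExtConcentrated ω d) (H : ModuleCat.{u} R)
    [Module.Finite R H] [Nontrivial H] (hH : SupportedAtClosedPoint (R := R) H) :
    Nontrivial (Ext H ω d) := by
  obtain ⟨f, hf⟩ := exists_injective_residueModule H hH
  have := hω.nontrivial_ext
  exact Function.Surjective.nontrivial (hω.exists_comp_eq hH hf)

variable {I : Ideal R} {J : ModuleCat.{u} R} {δ : Ext J ω d}

/-- Through `δ`, `Hom(-, J)` is `Ext^d(-, ω)`, which turns injections into surjections and is
nonzero on nonzero modules. -/
theorem injective_iff_exists_comp_eq (hω : ExtConcentrated ω d)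
    (hI : PrimeSpectrum.zeroLocus I ⊆ PrimeSpectrum.zeroLocus (maximalIdeal R : Set R))
    (hJ : ∀ (H : ModuleCat.{u} R) [Module.Finite R H], I ≤ Module.annihilator R H →
        Function.Bijective fun φ : H ⟶ J => (Ext.mk₀ φ).comp δ (zero_add d))
    {A B : ModuleCat.{u} R} [Module.Finite R A] [Module.Finite R B]
    (hA : I ≤ Module.annihilator R A) (hB : I ≤ Module.annihilator R B) (f : A ⟶ B) :
    Function.Injective f.hom ↔ ∀ φ : A ⟶ J, ∃ ψ : B ⟶ J, f ≫ ψ = φ := by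
  have hsupp : ∀ (H : ModuleCat.{u} R) [Module.Finite R H], I ≤ Module.annihilator R H →
      SupportedAtClosedPoint (R := R) H := fun H _ hH => by
    rw [SupportedAtClosedPoint, Module.support_eq_zeroLocus]
    exact (PrimeSpectrum.zeroLocus_anti_mono hH).trans hI
  have key : ∀ {A B : ModuleCat.{u} R} [Module.Finite R A] [Module.Finite R B]
      (_ : I ≤ Module.annihilator R A) (_ : I ≤ Module.annihilator R B) (f : A ⟶ B),
      Function.Injective f.hom → ∀ φ : A ⟶ J, ∃ ψ : B ⟶ J, f ≫ ψ = φ := by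
    intro A B _ _ hA hB f hf φ
    obtain ⟨e, he⟩ := hω.exists_comp_eq (hsupp B hB) hf ((Ext.mk₀ φ).comp δ (zero_add d))
    obtain ⟨ψ, rfl⟩ := (hJ B hB).2 e
    refine ⟨ψ, (hJ A hA).1 ?_⟩
    simpa only [Ext.mk₀_comp_mk₀_assoc] using he
  refine ⟨key hA hB f, fun h => ?_⟩
  let K : ModuleCat.{u} R := ModuleCat.of R (LinearMap.ker f.hom)
  let ι : K ⟶ A := ModuleCat.ofHom (LinearMap.ker f.hom).subtype
  have hι : Function.Injective ι.hom := (LinearMap.ker f.hom).injective_subtype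
  have hK : I ≤ Module.annihilator R K := hA.trans (ι.hom.annihilator_le_of_injective hι)
  rw [← LinearMap.ker_eq_bot, ← Submodule.subsingleton_iff_eq_bot]
  by_contra hne
  have hn : Nontrivial K := not_subsingleton_iff_nontrivial.mp hne
  have := hω.nontrivial_ext_of_supported K (hsupp K hK)
  -- A nonzero map `ker f → J` would extend to `A` and then factor through `f`, so it would vanish.
  obtain ⟨e, he⟩ := exists_ne (0 : Ext K ω d)
  obtain ⟨χ, rfl⟩ := (hJ K hK).2 e
  obtain ⟨φ, rfl⟩ := key hK hA ι hι χ
  obtain ⟨ψ, rfl⟩ := h φ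
  apply he
  have hzero : ι ≫ f ≫ ψ = 0 := by
    ext a
    change ψ.hom (f.hom a.1) = 0
    rw [LinearMap.mem_ker.mp a.2, map_zero]
  simp only [hzero, Ext.mk₀_zero, Ext.zero_comp]

/-- For `M` of finite length, `Ext^d(M, ω)` is a module of homomorphisms. -/
theorem exists_iso (hω : ExtConcentrated ω d) (M : ModuleCat.{u} R) [Module.Finite R M]
    [Nontrivial M] (hM : SupportedAtClosedPoint (R := R) M) :
    ∃ (J : ModuleCat.{u} R), Nonempty (ModuleCat.of R (M →ₗ[R] J) ≅ ModuleCat.of R (Ext M ω d)) ∧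
      ∀ {A B : ModuleCat.{u} R} [Module.Finite R A] [Module.Finite R B]
        (_ : Module.annihilator R M ≤ Module.annihilator R A)
        (_ : Module.annihilator R M ≤ Module.annihilator R B) (f : A ⟶ B),
        Function.Injective f.hom ↔ ∀ φ : A ⟶ J, ∃ ψ : B ⟶ J, f ≫ ψ = φ := by
  have := hω.finite
  have := hω.nontrivial
  have hlt : Module.annihilator R M < ⊤ := lt_top_iff_ne_top.mpr
    (fun h => not_subsingleton M (Module.annihilator_eq_top_iff.mp h))
  have hI : Module.annihilator R M ≤ Ideal.jacobson ⊥ :=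
    (le_maximalIdeal hlt.ne).trans (maximalIdeal_le_jacobson _)
  -- Vanishing of `Ext^i(M, ω)` for `i < d` yields an `ω`-regular sequence of length `d` in `Ann M`.
  obtain ⟨rs, rfl, hrs, hreg⟩ := ModuleCat.exists_isRegular_of_exists_subsingleton_ext
    (Module.annihilator R M) d ω
    (lt_top_iff_ne_top.mpr (Ne.symm (Submodule.top_ne_ideal_smul_of_le_jacobson_annihilator
        (hI.trans (Ideal.jacobson_mono bot_le))))) M Module.support_eq_zeroLocus
    (fun i hi => hω.subsingleton_ext_of_supported M hM hi.ne)
  obtain ⟨J, δ, hJ⟩ := exists_ext_comp_bijective ω rs hrs hI hreg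
  refine ⟨J, ⟨LinearEquiv.toModuleIso (LinearEquiv.ofBijective
    (M := M →ₗ[R] J) (M₂ := Ext M ω rs.length)
    { toFun := fun φ => (Ext.mk₀ (ModuleCat.ofHom φ)).comp δ (zero_add _)
      map_add' := fun φ ψ => by rw [ModuleCat.ofHom_add, Ext.mk₀_add, Ext.add_comp]
      map_smul' := fun r φ => by
        have : ModuleCat.ofHom (r • φ) = r • ModuleCat.ofHom φ := rfl
        rw [this, Ext.mk₀_smul, Ext.smul_comp, RingHom.id_apply] }
    ((hJ M le_rfl).comp (ModuleCat.homEquiv.symm.bijective)))⟩, fun hA hB f => ?_⟩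
  rw [SupportedAtClosedPoint, Module.support_eq_zeroLocus] at hM
  exact hω.injective_iff_exists_comp_eq hM hJ hA hB f

theorem subsingleton_ext_iff_of_supported (hω : ExtConcentrated ω d) (M : ModuleCat.{u} R)
    [Module.Finite R M] (hM : SupportedAtClosedPoint (R := R) M) (N : ModuleCat.{u} R)
    [Module.Finite R N] [Nontrivial M] (i : ℕ) :
    Subsingleton (Ext N (ModuleCat.of R (Ext M ω d)) (i + 1)) ↔
      Subsingleton (Ext N (charDual M) (i + 1)) := by
  obtain ⟨J, ⟨e⟩, hJ⟩ := hω.exists_iso M hM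
  rw [← subsingleton_ext_congr (Iso.refl N) e]
  induction i generalizing N with
  | zero =>
    obtain ⟨Z, L, f, g, w, hS, _, _, _⟩ := exists_shortExact_free N
    have := projective_of_free L
    rw [zero_add, subsingleton_ext_one_iff_of_projective hS,
      subsingleton_ext_one_iff_of_projective hS]
    have h₁ : (∀ φ : Z ⟶ charDual M, ∃ ψ : L ⟶ charDual M, f ≫ ψ = φ) ↔
        Function.Injective (f.hom.rTensor M) := by
      rw [rTensor_injective_iff_lcomp_surjective]
      constructor
      · intro h φ
        obtain ⟨ψ, hψ⟩ := h (ModuleCat.ofHom φ)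
        exact ⟨ψ.hom, congrArg ModuleCat.Hom.hom hψ⟩
      · intro h φ
        obtain ⟨ψ, hψ⟩ := h φ.hom
        exact ⟨ModuleCat.ofHom ψ, ModuleCat.hom_ext hψ⟩
    have h₂ := hJ (annihilator_le_annihilator_tensor Z M) (annihilator_le_annihilator_tensor L M)
      (ModuleCat.ofHom (X := Z ⊗[R] M) (Y := L ⊗[R] M) (f.hom.rTensor M))
    -- What remains is the adjunction `Hom(Z, Hom(M, J)) = Hom(Z ⊗ M, J)`.
    refine Iff.trans ?_ (h₂.symm.trans h₁.symm)
    constructor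
    · intro h φ
      obtain ⟨ψ, hψ⟩ := h (ModuleCat.ofHom (TensorProduct.curry φ.hom))
      refine ⟨ModuleCat.ofHom (TensorProduct.lift ψ.hom), ModuleCat.hom_ext ?_⟩
      refine TensorProduct.ext' fun z m => ?_
      exact LinearMap.congr_fun (LinearMap.congr_fun (congrArg ModuleCat.Hom.hom hψ) z) m
    · intro h φ
      obtain ⟨ψ, hψ⟩ := h (ModuleCat.ofHom (TensorProduct.lift φ.hom))
      refine ⟨ModuleCat.ofHom (TensorProduct.curry ψ.hom), ModuleCat.hom_ext ?_⟩
      refine LinearMap.ext fun z => LinearMap.ext fun m => ?_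
      exact LinearMap.congr_fun (congrArg ModuleCat.Hom.hom hψ) (z ⊗ₜ m)
  | succ i ih =>
    obtain ⟨Z, L, f, g, w, hS, _, _, _⟩ := exists_shortExact_free N
    have := projective_of_free L
    have shift : ∀ Y : ModuleCat.{u} R, Subsingleton (Ext N Y (i + 1 + 1)) ↔
        Subsingleton (Ext Z Y (i + 1)) := fun Y =>
      subsingleton_ext_X₃_iff hS Y (add_comm 1 (i + 1))
        (subsingleton_ext_of_projective _ _ _) (subsingleton_ext_of_projective _ _ _)
    rw [shift, shift]
    exact ih Z

/-- Modulo a regular `x`, vanishing of `Ext^{j+1}(M/xM, ω)` makes `x` surjective on `Ext^j(M, ω)`,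
and Nakayama applies. -/
theorem subsingleton_ext_of_isWeaklyRegular (hω : ExtConcentrated ω d) (rs : List R)
    (hrs : ∀ r ∈ rs, r ∈ maximalIdeal R) (M : ModuleCat.{u} R) [Module.Finite R M]
    (hreg : RingTheory.Sequence.IsWeaklyRegular M rs)
    (hdim : Module.supportDim R M = rs.length) (j : ℕ) (hj : j + rs.length ≠ d) :
    Subsingleton (Ext M ω j) := by
  have := hω.finite
  induction rs generalizing M j with
  | nil =>
    exact hω.subsingleton_ext_of_supported M (support_of_supportDim_eq_zero R M hdim).le hj
  | cons x rs ih =>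
    rw [RingTheory.Sequence.isWeaklyRegular_cons_iff] at hreg
    have hx := hrs x List.mem_cons_self
    obtain ⟨g, w, hS⟩ := exists_shortExact_quotSMulTop hreg.1
    have hdim' : Module.supportDim R (QuotSMulTop x M) = rs.length := by
      have := Module.supportDim_quotSMulTop_succ_eq_supportDim hreg.1 hx
      rw [hdim, List.length_cons, Nat.cast_add, Nat.cast_one] at this
      exact (ENat.WithBot.add_one_cancel).mp this
    have h := ih (fun r hr => hrs r (List.mem_cons_of_mem x hr))
      (ModuleCat.of R (QuotSMulTop x M)) hreg.2 hdim' (j + 1)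
      (by rw [List.length_cons] at hj; omega)
    refine subsingleton_of_surjective_lsmul hx fun e => ?_
    obtain ⟨e', rfl⟩ := Ext.contravariant_sequence_exact₁ hS ω e (add_comm 1 j) (h.elim _ _)
    exact ⟨e', by simp [Ext.mk₀_smul]⟩

theorem extEventuallyZero_iff (hω : ExtConcentrated ω d) (rs : List R)
    (hrs : ∀ r ∈ rs, r ∈ maximalIdeal R) (M N : ModuleCat.{u} R) [Module.Finite R M]
    [Module.Finite R N]
    (hreg : RingTheory.Sequence.IsWeaklyRegular M rs)
    (hdim : Module.supportDim R M = rs.length) (c : ℕ) (hc : c + rs.length = d) :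
    ExtEventuallyZero N (ModuleCat.of R (Ext M ω c)) ↔ ExtEventuallyZero N (charDual M) := by
  have := hω.finite
  induction rs generalizing M c with
  | nil =>
    obtain rfl : c = d := hc
    have hM := (support_of_supportDim_eq_zero R M hdim).le
    have : Nontrivial M := by
      rw [← Module.supportDim_ne_bot_iff_nontrivial R, hdim]
      exact WithBot.coe_ne_bot
    have key := hω.subsingleton_ext_iff_of_supported M hM N
    constructor
    · rintro ⟨n, hn⟩
      refine ⟨n + 1, fun i hi => ?_⟩
      obtain ⟨i, rfl⟩ := Nat.exists_eq_succ_of_ne_zero (show i ≠ 0 by omega)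
      exact (key i).mp (hn (i + 1) (by omega))
    · rintro ⟨n, hn⟩
      refine ⟨n + 1, fun i hi => ?_⟩
      obtain ⟨i, rfl⟩ := Nat.exists_eq_succ_of_ne_zero (show i ≠ 0 by omega)
      exact (key i).mpr (hn (i + 1) (by omega))
  | cons x rs ih =>
    have hreg' := hreg
    rw [RingTheory.Sequence.isWeaklyRegular_cons_iff] at hreg
    have hx := hrs x List.mem_cons_self
    obtain ⟨g, w, hS⟩ := exists_shortExact_quotSMulTop hreg.1
    have hdim' : Module.supportDim R (QuotSMulTop x M) = rs.length := by
      have := Module.supportDim_quotSMulTop_succ_eq_supportDim hreg.1 hx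
      rw [hdim, List.length_cons, Nat.cast_add, Nat.cast_one] at this
      exact (ENat.WithBot.add_one_cancel).mp this
    have hrs' : ∀ r ∈ rs, r ∈ maximalIdeal R := fun r hr => hrs r (List.mem_cons_of_mem x hr)
    rw [List.length_cons] at hc
    have hQ := hω.subsingleton_ext_of_isWeaklyRegular rs hrs'
      (ModuleCat.of R (QuotSMulTop x M)) hreg.2 hdim' c (by omega)
    have hM := hω.subsingleton_ext_of_isWeaklyRegular (x :: rs) hrs M hreg' hdim (c + 1)
      (by rw [List.length_cons]; omega)
    obtain ⟨g', w', hS'⟩ := exists_shortExact_ext hS ω hQ hM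
    exact (extEventuallyZero_X₃_iff N hx hS').symm.trans
      ((ih hrs' (ModuleCat.of R (QuotSMulTop x M)) hreg.2 hdim' (c + 1) (by omega)).trans
        (extEventuallyZero_charDual_quotSMulTop_iff M N hx hreg.1))

end ExtConcentrated

end Concentrated

/-! ### Canonical modules and the comparison for CM modules -/

section Main

variable {R : Type u} [CommRing R]

theorem eq_coe_toNat {x : WithBot ℕ∞} (h : x ≠ ⊥) (h' : x ≠ ⊤) :
    x = ((x.unbotD 0).toNat : ℕ) := by
  induction x with
  | bot => exact absurd rfl h
  | coe x =>
    induction x with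
    | top => exact absurd rfl h'
    | coe n => rfl

theorem subsingleton_charDual (M : ModuleCat.{u} R) [Subsingleton M] :
    Subsingleton (charDual M) :=
  ⟨fun a b => by
    ext x
    rw [Subsingleton.elim x 0, map_zero, map_zero]⟩

theorem torEventuallyZero_iff (M N : ModuleCat.{u} R) :
    TorEventuallyZero M N ↔ ExtEventuallyZero N (charDual M) := by
  constructor
  · rintro ⟨n, hn⟩
    refine ⟨n + 1, fun i hi => ?_⟩
    obtain ⟨i, rfl⟩ := Nat.exists_eq_succ_of_ne_zero (show i ≠ 0 by omega)
    exact (subsingleton_tor_iff M N i).mp (hn _ (by omega))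
  · rintro ⟨n, hn⟩
    refine ⟨n + 1, fun i hi => ?_⟩
    obtain ⟨i, rfl⟩ := Nat.exists_eq_succ_of_ne_zero (show i ≠ 0 by omega)
    exact (subsingleton_tor_iff M N i).mpr (hn _ (by omega))

theorem extEventuallyZero_charDual_comm [IsNoetherianRing R] (M N : ModuleCat.{u} R) [Module.Finite R M]
    [Module.Finite R N] :
    ExtEventuallyZero N (charDual M) ↔ ExtEventuallyZero M (charDual N) := by
  have key : ∀ (M N : ModuleCat.{u} R) [Module.Finite R M] [Module.Finite R N],
      ExtEventuallyZero N (charDual M) → ExtEventuallyZero M (charDual N) := by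
    rintro M N _ _ ⟨n, hn⟩
    refine ⟨n + 1, fun i hi => ?_⟩
    obtain ⟨i, rfl⟩ := Nat.exists_eq_succ_of_ne_zero (show i ≠ 0 by omega)
    exact (subsingleton_ext_charDual_comm M N i).mp (hn _ (by omega))
  exact ⟨key M N, key N M⟩

variable [IsLocalRing R]

theorem supportedAtClosedPoint_residueModule :
    SupportedAtClosedPoint (R := R) (residueModule R) := by
  rw [SupportedAtClosedPoint, Module.support_eq_zeroLocus]
  refine PrimeSpectrum.zeroLocus_anti_mono ?_
  exact (Ideal.annihilator_quotient (I := maximalIdeal R)).ge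

/-- A module whose depth equals its dimension `n` has a regular sequence of length `n`. -/
theorem exists_isWeaklyRegular_of_depth_eq {M : Type u} [AddCommGroup M] [Module R M] {n : ℕ}
    (h : depth R M = n) : ∃ rs : List R, rs.length = n ∧ (∀ r ∈ rs, r ∈ maximalIdeal R) ∧
      RingTheory.Sequence.IsWeaklyRegular M rs := by
  cases n with
  | zero => exact ⟨[], rfl, by simp, RingTheory.Sequence.IsWeaklyRegular.nil R M⟩
  | succ n =>
    have hlt : (n : ℕ∞) < depth R M := by
      rw [h]
      exact_mod_cast Nat.lt_succ_self n
    rw [depth, lt_iSup_iff] at hlt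
    obtain ⟨rs, hrs⟩ := hlt
    rw [lt_iSup_iff] at hrs
    obtain ⟨hreg, hlen⟩ := hrs
    have hle : (rs.length : ℕ∞) ≤ depth R M :=
      le_iSup₂ (f := fun (rs : List R) (_ : (∀ r ∈ rs, r ∈ maximalIdeal R) ∧
        RingTheory.Sequence.IsWeaklyRegular M rs) => (rs.length : ℕ∞)) rs hreg
    rw [h] at hle
    refine ⟨rs, ?_, hreg⟩
    have h₁ : n < rs.length := by exact_mod_cast hlen
    have h₂ : rs.length ≤ n + 1 := by exact_mod_cast hle
    omega

variable [IsNoetherianRing R]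

theorem ringKrullDim_eq_dim : ringKrullDim R = dim R R := by
  rw [dim, Module.supportDim_self_eq_ringKrullDim]
  exact eq_coe_toNat ringKrullDim_ne_bot ringKrullDim_ne_top

theorem supportDim_eq_dim (M : Type u) [AddCommGroup M] [Module R M] [Nontrivial M] :
    Module.supportDim R M = dim R M ∧ dim R M ≤ dim R R := by
  have hle := Module.supportDim_le_ringKrullDim R M
  rw [ringKrullDim_eq_dim] at hle
  have heq : Module.supportDim R M = dim R M :=
    eq_coe_toNat ((Module.supportDim_ne_bot_iff_nontrivial R M).mpr inferInstance)
      ((hle.trans_lt (WithBot.coe_lt_coe.mpr (ENat.natCast_lt_top _))).ne)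
  rw [heq] at hle
  exact ⟨heq, by exact_mod_cast hle⟩

theorem IsCohenMacaulay.exists_isWeaklyRegular {M : Type u} [AddCommGroup M] [Module R M]
    [Nontrivial M] (hM : IsCohenMacaulay R M) :
    ∃ rs : List R, rs.length = dim R M ∧ (∀ r ∈ rs, r ∈ maximalIdeal R) ∧
      RingTheory.Sequence.IsWeaklyRegular M rs := by
  refine exists_isWeaklyRegular_of_depth_eq ?_
  have h := hM.resolve_left (not_subsingleton M)
  rw [(supportDim_eq_dim M).1] at h
  exact_mod_cast h

/-- Over a Cohen-Macaulay local ring of dimension `d`, a module of finite injective dimension has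
no `Ext^i(k, -)` for `i > d`. -/
theorem subsingleton_ext_residueModule_of_dim_lt (hR : IsCohenMacaulay R R) (Y : ModuleCat.{u} R)
    (hY : injectiveDimension Y ≠ ⊤) {i : ℕ} (hi : dim R R < i) :
    Subsingleton (Ext (residueModule R) Y i) := by
  obtain ⟨n, hn⟩ := (injectiveDimension_ne_top_iff Y).mp hY
  obtain ⟨rs, hlen, hrs, hreg⟩ := hR.exists_isWeaklyRegular
  have hreg' := (isRegular_iff_isWeaklyRegular_of_subset_maximalIdeal hrs).mpr hreg
  -- This quotient has finite length and projective dimension `d`, and it contains a copy of `k`.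
  let A : ModuleCat.{u} R := ModuleCat.of R (R ⧸ Ideal.ofList rs • (⊤ : Submodule R R))
  have hA : Nontrivial A :=
    Submodule.Quotient.nontrivial_iff.mpr (Ne.symm hreg'.2)
  have hAs : SupportedAtClosedPoint (R := R) A := by
    refine (support_of_supportDim_eq_zero R A ?_).le
    have h := Module.supportDim_add_length_eq_supportDim_of_isRegular rs hreg'
    rw [(supportDim_eq_dim (R := R) R).1, hlen] at h
    have h' := (supportDim_eq_dim (R := R) A).1
    change Module.supportDim R A + _ = _ at h
    rw [h'] at h ⊢
    have h'' : dim R A + dim R R = dim R R := by exact_mod_cast h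
    exact_mod_cast (show dim R A = 0 by omega)
  have hpd : HasProjectiveDimensionLT A (dim R R + 1) := by
    rw [← projectiveDimension_lt_iff,
      ModuleCat.projectiveDimension_quotient_eq_add_length_of_isWeaklyRegular
        (ModuleCat.of R R) rs hreg hrs, hlen]
    have : projectiveDimension (ModuleCat.of R R) ≤ 0 :=
      (projectiveDimension_le_iff _ 0).mpr
        (inferInstanceAs (HasProjectiveDimensionLT (ModuleCat.of R R) 1))
    calc
      projectiveDimension (ModuleCat.of R R) + (dim R R : WithBot ℕ∞)
        ≤ 0 + (dim R R : WithBot ℕ∞) := by gcongr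
      _ < ((dim R R + 1 : ℕ) : WithBot ℕ∞) := by
        rw [zero_add]
        exact_mod_cast Nat.lt_succ_self _
  obtain ⟨f, hf⟩ := exists_injective_residueModule A hAs
  -- Descending induction on `i` from the injective dimension bound: `Ext^i(k, Y)` lies between
  -- `Ext^i(A, Y) = 0` and `Ext^{i+1}(A/k, Y) = 0`.
  have key : ∀ k i, dim R R < i → n + 1 ≤ i + k → Subsingleton (Ext (residueModule R) Y i) := by
    intro k
    induction k with
    | zero => exact fun i _ hi => HasInjectiveDimensionLT.subsingleton Y (n + 1) i hi _
    | succ k ih =>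
      intro i hi hik
      have hQ : SupportedAtClosedPoint (R := R) (A ⧸ LinearMap.range f.hom) :=
        (Module.support_subset_of_surjective _ (Submodule.mkQ_surjective _)).trans hAs
      have hQ' := SupportedAtClosedPoint.subsingleton_ext Y (ih (i + 1) (by omega) (by omega))
        (ModuleCat.of R (A ⧸ LinearMap.range f.hom)) hQ
      have hA' : Subsingleton (Ext A Y i) := HasProjectiveDimensionLT.subsingleton A _ i hi Y
      refine subsingleton_of_forall_eq 0 fun e => ?_
      obtain ⟨e', rfl⟩ := Ext.contravariant_sequence_exact₁ (shortExact_cokernel hf) Y e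
        (add_comm 1 i) (hQ'.elim _ _)
      rw [hA'.elim e' 0, Ext.comp_zero]
  exact key (n + 1) i hi (by omega)

/-- Depth gives vanishing below `d`, finite injective dimension gives it above, and type one gives
nonvanishing at `d`. -/
theorem IsCanonicalModule.extConcentrated (hR : IsCohenMacaulay R R) {ω : ModuleCat.{u} R}
    (hω : IsCanonicalModule ω) : ExtConcentrated ω (dim R R) := by
  have := hω.finite
  have hn : Nontrivial ω := by
    rw [← Module.supportDim_ne_bot_iff_nontrivial R, hω.supportDim_eq, ringKrullDim_eq_dim]
    exact WithBot.coe_ne_bot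
  have hdim : dim R ω = dim R R := by
    rw [dim, dim, hω.supportDim_eq, Module.supportDim_self_eq_ringKrullDim]
  have hdepth : depth R ω = dim R R := by
    have h := hω.isCohenMacaulay.resolve_left (not_subsingleton ω)
    rw [hω.supportDim_eq, ringKrullDim_eq_dim] at h
    exact_mod_cast h
  refine ⟨hω.finite, fun i hi => ?_, ?_⟩
  · rcases lt_or_gt_of_ne hi with hi | hi
    · obtain ⟨rs, hlen, hrs, hreg⟩ := hω.isCohenMacaulay.exists_isWeaklyRegular
      have hreg' := (isRegular_iff_isWeaklyRegular_of_subset_maximalIdeal hrs).mpr hreg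
      refine ModuleCat.subsingleton_ext_of_exists_isRegular (maximalIdeal R) (residueModule R)
        supportedAtClosedPoint_residueModule ω ?_ rs hrs hreg' i (by omega)
      exact lt_top_iff_ne_top.mpr (Ne.symm (Submodule.top_ne_ideal_smul_of_le_jacobson_annihilator
        (maximalIdeal_le_jacobson _)))
    · exact subsingleton_ext_residueModule_of_dim_lt hR ω hω.injectiveDimension_ne_top hi
  · have h := hω.cmType_eq_one
    rw [cmType, hdepth, ENat.toNat_natCast] at h
    exact rank_pos_iff_nontrivial.mp (h ▸ zero_lt_one)

theorem extEventuallyZero_plus_iff (hR : IsCohenMacaulay R R) {ω : ModuleCat.{u} R}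
    (hω : IsCanonicalModule ω) (M N : ModuleCat.{u} R) [Module.Finite R M] [Module.Finite R N]
    (hM : IsCohenMacaulay R M) :
    ExtEventuallyZero N (plus ω M) ↔ ExtEventuallyZero N (charDual M) := by
  rcases subsingleton_or_nontrivial M with h | h
  · have hzero : ∀ Y : ModuleCat.{u} R, Subsingleton Y → ExtEventuallyZero N Y := fun Y _ => by
      have := (ModuleCat.isZero_of_subsingleton Y).injective
      refine ⟨1, fun i hi => ?_⟩
      obtain ⟨i, rfl⟩ := Nat.exists_eq_succ_of_ne_zero (show i ≠ 0 by omega)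
      exact subsingleton_ext_of_injective N Y i
    refine iff_of_true (hzero _ ?_) (hzero _ (subsingleton_charDual M))
    exact (subsingleton_iff_forall_eq (0 : Ext M ω _)).mpr fun e => by
      rw [← e.mk₀_id_comp, (Limits.IsZero.iff_id_eq_zero M).mp
        (ModuleCat.isZero_of_subsingleton M), Ext.mk₀_zero, Ext.zero_comp]
  · obtain ⟨rs, hlen, hrs, hreg⟩ := hM.exists_isWeaklyRegular
    obtain ⟨hdim, hle⟩ := supportDim_eq_dim (R := R) M
    exact (hω.extConcentrated hR).extEventuallyZero_iff rs hrs M N hreg (by rw [hdim, hlen])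
      (dim R R - dim R M) (by omega)

end Main

end CMVanishing

end

theorem mainTheorem2 {R : Type u} [CommRing R] [IsLocalRing R] [IsNoetherianRing R]
    (hR : CMVanishing.IsCohenMacaulay R R)
    (ω : ModuleCat.{u} R) (hω : CMVanishing.IsCanonicalModule ω)
    (M N : ModuleCat.{u} R) [Module.Finite R M] [Module.Finite R N]
    (hM : CMVanishing.IsCohenMacaulay R M) (hN : CMVanishing.IsCohenMacaulay R N) :
    List.TFAE
      [CMVanishing.ExtEventuallyZero M (CMVanishing.plus ω N),
        CMVanishing.ExtEventuallyZero N (CMVanishing.plus ω M),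
        CMVanishing.TorEventuallyZero M N] := by
  rw [CMVanishing.extEventuallyZero_plus_iff hR hω M N hM,
    CMVanishing.extEventuallyZero_plus_iff hR hω N M hN, CMVanishing.torEventuallyZero_iff,
    CMVanishing.extEventuallyZero_charDual_comm N M]
  tfae_finish
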